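/- Fix a set $\mathrm{Var}$ of variables, a set $A$ of actions and a signature $\Sigma$ of function symbols with finite arities. The set $\mathbb{T}(\Sigma)$ of terms with recursion is defined inductively: variables are terms; $f(t_1,\dots,t_n)$ is a term for each $n$-ary $f\in\Sigma$ and terms $t_i$; and $\langle X|S\rangle$ is a term for each recursive specification $S:V_S\to\mathbb{T}(\Sigma)$ with $X\in V_S\subseteq\mathrm{Var}$, in which the variables from $V_S$ are bound. Here $t[\sigma]$ denotes (capture-avoiding) substitution for the free variables of $t$, $T(\Sigma)$ is the set of closed terms (terms without free variables), and $\langle t|S\rangle$ is $t$ with $\langle Y|S\rangle$ substituted for each $Y\in V_S$. A closed substitution is a function $\rho:\mathrm{Var}\to T(\Sigma)$. Literals are expressions $t\xrightarrow{a}t'$ (positive) and $t\not\xrightarrow{a}$ (negative) with $t,t'\in\mathbb{T}(\Sigma)$ and $a\in A$; $t\xrightarrow{a}t'$ and $t\not\xrightarrow{a}$ deny each other. A rule $\frac{H}{\alpha}$ has a set $H$ of literals as premises and a positive literal $\alpha$ as conclusion; the left- and right-hand sides of $\alpha$ are its source and target. A transition system specification (TSS) $P$ over $\Sigma$ is a set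 of rules. $P\vdash\frac{H}{\alpha}$ means that there is a well-founded tree of literals with root $\alpha$ in which each node either is a leaf labelled by an element of $H$, or forms together with its children a substitution instance of a rule of $P$. For ordinals $\lambda$ define sets $PT^-_\lambda, CT^-_\lambda$ of closed negative literals and $PT^+_\lambda,CT^+_\lambda$ of closed positive literals as follows: $PT^-_\lambda$ consists of the closed negative literals that deny no element of $\bigcup_{\kappa<\lambda}CT^+_\kappa$; $\beta\in PT^+_\lambda$ iff $P\vdash\frac{PT^-_\lambda}{\beta}$; $CT^-_\lambda$ consists of the closed negative literals that deny no element of $PT^+_\lambda$; and $\beta\in CT^+_\lambda$ iff $P\vdash\frac{CT^-_\lambda}{\beta}$. Let $\kappa$ be a closure ordinal, i.e. $PT^-_\lambda=PT^-_\kappa$ for all $\lambda>\kappa$. The well-founded semantics of $P$ is the 3-valued transition relation $\langle CT^+,PT^+\rangle:=\langle CT^+_\kappa,PT^+_\kappa\rangle$ of certain and possible transitions. A bisimulation is a relation $\mathcal{R}$ on $T(\Sigma)$ such that, whenever $p\mathrel{\mathcal R}q$ and $a\in A$: if $(p\xrightarrow{a}p')\in CT^+$ then there is a $q'$ with $(q\xrightarrow{a}q')\in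 CT^+$ and $p'\mathrel{\mathcal R}q'$; and if $(q\xrightarrow{a}q')\in PT^+$ then there is a $p'$ with $(p\xrightarrow{a}p')\in PT^+$ and $p'\mathrel{\mathcal R}q'$. Write $p\sqsubseteq_B q$ ($q$ is a modal refinement of $p$) if $p\mathrel{\mathcal R}q$ for some bisimulation $\mathcal R$. An ntytt rule is a rule in which the right-hand sides of the positive premises are variables that are all distinct and do not occur in the source. It is an ntyxt rule if its source is a variable, and an ntyft rule if its source has the form $f(x_1,\dots,x_n)$ with distinct variables $x_i$. A TSS is in the ntyft/ntyxt format with recursion if for each recursive specification $S$, each $X\in V_S$ and each $a\in A$ it has a rule $$\frac{\langle S_X|S\rangle\xrightarrow{a}z}{\langle X|S\rangle\xrightarrow{a}z}$$ with $z$ a variable, and all its other rules are ntyft or ntyxt rules. **Theorem.** For every TSS in the ntyft/ntyxt format with recursion, the bisimulation preorder $\sqsubseteq_B$ is a lean precongruence: it is a preorder on $T(\Sigma)$, and $t[\rho]\sqsubseteq_B t[\nu]$ for every term $t\in\mathbb{T}(\Sigma)$ and all closed substitutions $\rho,\nu$ such that $\rho(x)\sqsubseteq_B\nu(x)$ for each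 $x\in\mathrm{Var}$. -/

import Mathlib

universe u v w

/-- A signature: a collection of function symbols, each with a finite arity. -/
structure Signature : Type (w + 1) where
  Sym : Type w
  arity : Sym → ℕ

/-- `Term Sg Var W` is the set `𝕋(Σ, W)` of terms with recursion over the signature `Sg` whose free
variables are drawn from `W`. The names of recursion variables are taken from `Var`.

A recursive specification with set of recursion variables `V ⊆ Var` gives a right-hand side `S Y`
for each `Y ∈ V`. In `S Y` an occurrence of a recursion variable `Z ∈ V` is written `Sum.inr Z`,
and an occurrence of a variable `x` that is not bound by this specification is written `Sum.inl x`.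
So bound and free occurrences are kept apart by the syntax, and substitution never has to rename
bound variables in order to avoid name clashes. -/
inductive Term (Sg : Signature.{w}) (Var : Type u) : Type u → Type (max (u + 1) w)
  | var {W : Type u} (x : W) : Term Sg Var W
  | op {W : Type u} (f : Sg.Sym) (args : Fin (Sg.arity f) → Term Sg Var W) : Term Sg Var W
  | recur {W : Type u} (V : Set Var) (S : V → Term Sg Var (W ⊕ V)) (X : V) : Term Sg Var W

namespace Term

variable {Sg : Signature.{w}} {Var : Type u}

/-- The set of variables that occur free in a term. -/
def vars : {W : Type u} → Term Sg Var W → Set W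
  | _, var x => {x}
  | _, op _ args => {x | ∃ i, x ∈ (args i).vars}
  | _, recur _ S _ => {x | ∃ Y, Sum.inl x ∈ (S Y).vars}

/-- Renaming of free variables. -/
def rename : {W : Type u} → Term Sg Var W → {W' : Type u} → (W → W') → Term Sg Var W'
  | _, var x, _, g => var (g x)
  | _, op f args, _, g => op f (fun i => (args i).rename g)
  | _, recur V S X, _, g => recur V (fun Y => (S Y).rename (Sum.map g id)) X

/-- `t.subst σ` is the substitution instance `t[σ]`: each free occurrence of `x` is replaced by
`σ x`. A partial substitution is one with `σ x = var x` for `x` outside its domain. -/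
def subst : {W : Type u} → Term Sg Var W → {W' : Type u} → (W → Term Sg Var W') → Term Sg Var W'
  | _, var x, _, σ => σ x
  | _, op f args, _, σ => op f (fun i => (args i).subst σ)
  | _, recur V S X, _, σ =>
      recur V (fun Y => (S Y).subst
        (Sum.elim (fun x => (σ x).rename Sum.inl) (fun Z => var (Sum.inr Z)))) X

/-- `unfold V S X` is `⟨S_X | S⟩`: the right-hand side `S_X`, with `⟨Y | S⟩` substituted for each
recursion variable `Y`. -/
def unfold {W : Type u} (V : Set Var) (S : V → Term Sg Var (W ⊕ V)) (X : V) : Term Sg Var W :=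
  (S X).subst (Sum.elim var (fun Y => recur V S Y))

end Term

/-- The set `T(Σ)` of closed terms. -/
abbrev ClosedTerm (Sg : Signature.{w}) (Var : Type u) : Type (max (u + 1) w) :=
  Term Sg Var PEmpty.{u + 1}

/-- Literals `t -a→ t'` (positive) and `t -a↛` (negative), over terms with free variables
from `W`. -/
inductive Literal (Sg : Signature.{w}) (Var : Type u) (A : Type v) (W : Type u) :
    Type (max (u + 1) v w)
  | pos (t : Term Sg Var W) (a : A) (t' : Term Sg Var W) : Literal Sg Var A W
  | neg (t : Term Sg Var W) (a : A) : Literal Sg Var A W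

namespace Literal

variable {Sg : Signature.{w}} {Var : Type u} {A : Type v} {W W' : Type u}

def subst (l : Literal Sg Var A W) (σ : W → Term Sg Var W') : Literal Sg Var A W' :=
  match l with
  | pos t a t' => pos (t.subst σ) a (t'.subst σ)
  | neg t a => neg (t.subst σ) a

/-- A closed literal, regarded as a literal over `Var`. -/
def ofClosed (l : Literal Sg Var A PEmpty.{u + 1}) : Literal Sg Var A Var :=
  l.subst (fun x => x.elim)

def IsPos : Literal Sg Var A W → Prop
  | pos _ _ _ => True
  | neg _ _ => False

def IsNeg : Literal Sg Var A W → Prop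
  | pos _ _ _ => False
  | neg _ _ => True

/-- The literals `t -a→ t'` and `t -a↛` deny each other. -/
def Denies : Literal Sg Var A W → Literal Sg Var A W → Prop
  | pos t a _, neg s b => t = s ∧ a = b
  | neg t a, pos s b _ => t = s ∧ a = b
  | _, _ => False

end Literal

/-- A transition rule, with conclusion `source -label→ target`. -/
structure Rule (Sg : Signature.{w}) (Var : Type u) (A : Type v) : Type (max (u + 1) v w) where
  premises : Set (Literal Sg Var A Var)
  source : Term Sg Var Var
  label : A
  target : Term Sg Var Var

namespace Rule

variable {Sg : Signature.{w}} {Var : Type u} {A : Type v}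

def conclusion (r : Rule Sg Var A) : Literal Sg Var A Var :=
  Literal.pos r.source r.label r.target

/-- The right-hand sides of the positive premises are variables that are all distinct and do not
occur in the source. -/
def IsNtytt (r : Rule Sg Var A) : Prop :=
  (∀ t a t', Literal.pos t a t' ∈ r.premises → ∃ y, t' = Term.var y ∧ y ∉ r.source.vars) ∧
  (∀ t a s b y, Literal.pos t a (Term.var y) ∈ r.premises →
    Literal.pos s b (Term.var y) ∈ r.premises → t = s ∧ a = b)

/-- An ntytt rule whose source is a variable. -/
def IsNtyxt (r : Rule Sg Var A) : Prop :=
  r.IsNtytt ∧ ∃ x, r.source = Term.var x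

/-- An ntytt rule whose source is `f(x₁, …, xₙ)` with distinct variables `xᵢ`. -/
def IsNtyft (r : Rule Sg Var A) : Prop :=
  r.IsNtytt ∧ ∃ (f : Sg.Sym) (x : Fin (Sg.arity f) → Var),
    Function.Injective x ∧ r.source = Term.op f (fun i => Term.var (x i))

/-- The recursion rule with premise `⟨S_X | S⟩ -a→ z` and conclusion `⟨X | S⟩ -a→ z`. -/
def recursion (V : Set Var) (S : V → Term Sg Var (Var ⊕ V)) (X : V) (a : A) (z : Var) :
    Rule Sg Var A where
  premises := {Literal.pos (Term.unfold V S X) a (Term.var z)}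
  source := Term.recur V S X
  label := a
  target := Term.var z

end Rule

/-- A transition system specification over the signature `Sg`, given by its set of rules. -/
structure TSS (Sg : Signature.{w}) (Var : Type u) (A : Type v) : Type (max (u + 1) v w) where
  rules : Set (Rule Sg Var A)

namespace TSS

variable {Sg : Signature.{w}} {Var : Type u} {A : Type v}

/-- The ntyft/ntyxt format with recursion: there is a recursion rule for every recursive
specification `S`, recursion variable `X` and action `a`, and all other rules are ntyft or ntyxt
rules. -/
def IsNtyftNtyxtWithRecursion (P : TSS Sg Var A) : Prop :=
  (∀ (V : Set Var) (S : V → Term Sg Var (Var ⊕ V)) (X : V) (a : A),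
    ∃ z, Rule.recursion V S X a z ∈ P.rules) ∧
  (∀ r ∈ P.rules, (∃ V S X a z, r = Rule.recursion V S X a z) ∨ r.IsNtyft ∨ r.IsNtyxt)

/-- `P.Provable H α` means that there is a proof of the transition rule `H / α` from `P`, i.e. a
well-founded tree of literals with root `α`, in which each node is either a leaf labelled by an
element of `H`, or is together with its children a substitution instance of a rule of `P`. -/
inductive Provable (P : TSS Sg Var A) (H : Set (Literal Sg Var A Var)) :
    Literal Sg Var A Var → Prop
  | hyp {β : Literal Sg Var A Var} : β ∈ H → Provable P H β
  | rule {r : Rule Sg Var A} (hr : r ∈ P.rules) (σ : Var → Term Sg Var Var) :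
      (∀ l ∈ r.premises, Provable P H (l.subst σ)) → Provable P H (r.conclusion.subst σ)

/-- The closed positive literals `β` for which `N / β` is provable from `P`. -/
def consequences (P : TSS Sg Var A) (N : Set (Literal Sg Var A PEmpty.{u + 1})) :
    Set (Literal Sg Var A PEmpty.{u + 1}) :=
  {β | β.IsPos ∧ P.Provable (Literal.ofClosed '' N) β.ofClosed}

/-- The closed negative literals that do not deny any literal in `B`. -/
def undenied (B : Set (Literal Sg Var A PEmpty.{u + 1})) :
    Set (Literal Sg Var A PEmpty.{u + 1}) :=
  {l | l.IsNeg ∧ ∀ β ∈ B, ¬ l.Denies β}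

/-- The set `CT⁺_o` (see `ctPos_eq` for its defining equation). -/
def ctPos (P : TSS Sg Var A) (o : Ordinal.{max (u + 1) v w}) :
    Set (Literal Sg Var A PEmpty.{u + 1}) :=
  P.consequences (undenied (P.consequences (undenied
    {β | ∃ k, ∃ _ : k < o, β ∈ ctPos P k})))
termination_by o

/-- The set `PT⁻_o`: the closed negative literals that do not deny any literal in `CT⁺_k`
with `k < o`. -/
def ptNeg (P : TSS Sg Var A) (o : Ordinal.{max (u + 1) v w}) :
    Set (Literal Sg Var A PEmpty.{u + 1}) :=
  undenied {β | ∃ k, ∃ _ : k < o, β ∈ P.ctPos k}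

/-- The set `PT⁺_o`: the closed positive literals provable from `P` under hypotheses `PT⁻_o`. -/
def ptPos (P : TSS Sg Var A) (o : Ordinal.{max (u + 1) v w}) :
    Set (Literal Sg Var A PEmpty.{u + 1}) :=
  P.consequences (P.ptNeg o)

/-- The set `CT⁻_o`: the closed negative literals that do not deny any literal in `PT⁺_o`. -/
def ctNeg (P : TSS Sg Var A) (o : Ordinal.{max (u + 1) v w}) :
    Set (Literal Sg Var A PEmpty.{u + 1}) :=
  undenied (P.ptPos o)

/-- `CT⁺_o` consists of the closed positive literals provable from `P` under hypotheses
`CT⁻_o`. -/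
theorem ctPos_eq (P : TSS Sg Var A) (o : Ordinal.{max (u + 1) v w}) :
    P.ctPos o = P.consequences (P.ctNeg o) := by
  rw [ctPos]
  rfl

theorem ptNeg_antitone (P : TSS Sg Var A) : Antitone P.ptNeg := by
  intro i j hij l hl
  refine ⟨hl.1, ?_⟩
  rintro β ⟨k, hk, hβ⟩
  exact hl.2 β ⟨k, hk.trans_le hij, hβ⟩

/-- `k` is a closure ordinal if the sets `PT⁻_o` are constant from `k` on. -/
def IsClosureOrdinal (P : TSS Sg Var A) (k : Ordinal.{max (u + 1) v w}) : Prop :=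
  ∀ o, k < o → P.ptNeg o = P.ptNeg k

theorem exists_isClosureOrdinal (P : TSS Sg Var A) : ∃ k, P.IsClosureOrdinal k := by
  let rk : Literal Sg Var A PEmpty.{u + 1} → Ordinal.{max (u + 1) v w} :=
    fun l => sInf {o | l ∉ P.ptNeg o}
  refine ⟨⨆ l, rk l, fun o ho => ?_⟩
  apply Set.Subset.antisymm (P.ptNeg_antitone ho.le)
  intro l hl
  by_contra hlo
  have h1 : l ∉ P.ptNeg (rk l) := csInf_mem (s := {o | l ∉ P.ptNeg o}) ⟨o, hlo⟩
  exact h1 (P.ptNeg_antitone (Ordinal.le_iSup rk l) hl)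

/-- A closure ordinal of `P`. -/
noncomputable def closureOrdinal (P : TSS Sg Var A) : Ordinal.{max (u + 1) v w} :=
  Classical.choose P.exists_isClosureOrdinal

/-- The certain transitions `p -a→ q`, i.e. those in `CT⁺`, of the well-founded semantics. -/
def Certain (P : TSS Sg Var A) (p : ClosedTerm Sg Var) (a : A) (q : ClosedTerm Sg Var) : Prop :=
  Literal.pos p a q ∈ P.ctPos P.closureOrdinal

/-- The possible transitions `p -a⇢ q`, i.e. those in `PT⁺`, of the well-founded semantics. -/
def Possible (P : TSS Sg Var A) (p : ClosedTerm Sg Var) (a : A) (q : ClosedTerm Sg Var) : Prop :=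
  Literal.pos p a q ∈ P.ptPos P.closureOrdinal

/-- Bisimulations on the 3-valued transition relation of `P`. -/
structure IsBisimulation (P : TSS Sg Var A)
    (R : ClosedTerm Sg Var → ClosedTerm Sg Var → Prop) : Prop where
  certain : ∀ p q a p', R p q → P.Certain p a p' → ∃ q', P.Certain q a q' ∧ R p' q'
  possible : ∀ p q a q', R p q → P.Possible q a q' → ∃ p', P.Possible p a p' ∧ R p' q'

/-- The bisimulation preorder: `q` is a modal refinement of `p`. -/
def BisimPreorder (P : TSS Sg Var A) (p q : ClosedTerm Sg Var) : Prop :=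
  ∃ R, P.IsBisimulation R ∧ R p q

end TSS

/-- A preorder on closed terms is a lean precongruence if `t[ρ] ⊑ t[ν]` for every term `t` and all
closed substitutions `ρ ⊑ ν`. -/
structure IsLeanPrecongruence {Sg : Signature.{w}} {Var : Type u}
    (r : ClosedTerm Sg Var → ClosedTerm Sg Var → Prop) : Prop where
  refl : ∀ p, r p p
  trans : ∀ p q s, r p q → r q s → r p s
  lean : ∀ (t : Term Sg Var Var) (ρ ν : Var → ClosedTerm Sg Var),
    (∀ x, r (ρ x) (ν x)) → r (t.subst ρ) (t.subst ν)

/-! The relation ⊑_B is itself a reflexive bisimulation, so it suffices that the lean closure of a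
reflexive bisimulation `B` is again a bisimulation. Pairs from `B` are added to the syntax as
constants. A closed term `t` over them has two evaluations, `left` and `right`, taking first or
second components; the lean closure relates `t.left` to `t.right`.

To transfer a transition from `t.left` to `t.right`, one follows its proof. The obstacle is that
premises need not be well-founded: the variable on the right of a premise may occur, even
cyclically, in left-hand sides, so lifted values cannot be chosen one after another. They are found
together as a least fixed point. For this the terms over a given left evaluation `p` are ordered so
that `(p, p)` is least and a pair `(p, q)` with `p ≠ q` is maximal. Each such fiber is
chain-complete (`Le.exists_lub`), and a provable transition `p -a→ p'` lifts to a monotone map from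
the fiber of `p` to that of `p'` (`ClosedProvable.liftable`). Monotonicity is the induction
invariant that makes the fixed points available; leastness makes the new map monotone in turn.

Negative premises are treated by ordinal induction on the stages of the well-founded semantics
(`IsBisimulation.leanClosure_stage`): stage `o` is compared with the closure stage, and the
inclusions between the two supply what lifting requires. -/

/-! ### Renaming and substitution -/

namespace Term

variable {Sg : Signature.{w}} {Var : Type u}

theorem rename_rename {W : Type u} (t : Term Sg Var W) : ∀ {W' W'' : Type u} (g : W → W')
    (h : W' → W''), (t.rename g).rename h = t.rename (h ∘ g) := by
  induction t with
  | var x => intros; rfl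
  | op f args ih => intros; simp only [rename, ih]
  | recur V S X ih =>
    intros
    simp only [rename, ih]
    congr 1; funext Y; congr 1; funext z; cases z <;> rfl

theorem rename_id {W : Type u} (t : Term Sg Var W) : t.rename id = t := by
  induction t with
  | var x => rfl
  | op f args ih => simp only [rename, ih]
  | recur V S X ih => simp only [rename, Sum.map_id_id, ih]

theorem subst_rename {W : Type u} (t : Term Sg Var W) : ∀ {W' W'' : Type u} (g : W → W')
    (σ : W' → Term Sg Var W''), (t.rename g).subst σ = t.subst (fun x => σ (g x)) := by
  induction t with
  | var x => intros; rfl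
  | op f args ih => intros; simp only [rename, subst, ih]
  | recur V S X ih =>
    intros
    simp only [rename, subst, ih]
    congr 1; funext Y; congr 1; funext z; cases z <;> rfl

theorem rename_subst {W : Type u} (t : Term Sg Var W) : ∀ {W' W'' : Type u}
    (σ : W → Term Sg Var W') (g : W' → W''),
    (t.subst σ).rename g = t.subst (fun x => (σ x).rename g) := by
  induction t with
  | var x => intros; rfl
  | op f args ih => intros; simp only [rename, subst, ih]
  | recur V S X ih =>
    intros
    simp only [rename, subst, ih]
    congr 1; funext Y; congr 1; funext z
    cases z with
    | inl x => simp only [Sum.elim_inl, rename_rename]; rfl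
    | inr x => rfl

theorem subst_subst {W : Type u} (t : Term Sg Var W) : ∀ {W' W'' : Type u}
    (σ : W → Term Sg Var W') (τ : W' → Term Sg Var W''),
    (t.subst σ).subst τ = t.subst (fun x => (σ x).subst τ) := by
  induction t with
  | var x => intros; rfl
  | op f args ih => intros; simp only [subst, ih]
  | recur V S X ih =>
    intros
    simp only [subst, ih]
    congr 1; funext Y; congr 1; funext z
    cases z with
    | inl x => simp only [Sum.elim_inl, subst_rename, rename_subst]
    | inr x => rfl

theorem subst_var {W : Type u} (t : Term Sg Var W) : t.subst var = t := by
  induction t with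
  | var x => rfl
  | op f args ih => simp only [subst, ih]
  | recur V S X ih =>
    simp only [subst]
    congr 1; funext Y
    conv_rhs => rw [← ih Y]
    congr 1; funext z; cases z <;> rfl

theorem rename_eq_subst {W W' : Type u} (t : Term Sg Var W) (g : W → W') :
    t.rename g = t.subst (fun x => var (g x)) := by
  conv_lhs => rw [← subst_var t, rename_subst]
  rfl

theorem subst_unfold {W W' : Type u} (V : Set Var) (S : V → Term Sg Var (W ⊕ V)) (X : V)
    (σ : W → Term Sg Var W') :
    (unfold V S X).subst σ = unfold V (fun Y => (S Y).subst
      (Sum.elim (fun x => (σ x).rename Sum.inl) (fun Z => var (Sum.inr Z)))) X := by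
  simp only [unfold, subst_subst]
  congr 1; funext z
  cases z with
  | inl x =>
    simp only [Sum.elim_inl, subst, subst_rename]
    exact (subst_var _).symm
  | inr x => rfl

theorem subst_closed (p : ClosedTerm Sg Var) (σ : PEmpty.{u + 1} → ClosedTerm Sg Var) :
    p.subst σ = p := by
  rw [Subsingleton.elim σ var, subst_var]

theorem rename_closed (p : ClosedTerm Sg Var) (g : PEmpty.{u + 1} → PEmpty.{u + 1}) :
    p.rename g = p := by
  rw [Subsingleton.elim g id, rename_id]

/-- Substituting any closed term for all variables undoes the renaming; `p` itself serves, which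
spares a nonemptiness hypothesis. -/
theorem rename_closed_injective {W : Type u} {g : PEmpty.{u + 1} → W} {p q : ClosedTerm Sg Var}
    (h : p.rename g = q.rename g) : p = q := by
  have := congrArg (fun t => t.subst (fun _ => p)) h
  simpa only [subst_rename, subst_closed] using this

end Term

/-! ### Terms with additional constants -/

/-- Terms with recursion that may contain elements of `L` as additional constants. -/
inductive TermWith (Sg : Signature.{w}) (Var : Type u) (L : Type (max (u + 1) w)) :
    Type u → Type (max (u + 1) w)
  | var {W : Type u} (x : W) : TermWith Sg Var L W
  | const {W : Type u} (l : L) : TermWith Sg Var L W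
  | op {W : Type u} (f : Sg.Sym) (args : Fin (Sg.arity f) → TermWith Sg Var L W) :
      TermWith Sg Var L W
  | recur {W : Type u} (V : Set Var) (S : V → TermWith Sg Var L (W ⊕ V)) (X : V) :
      TermWith Sg Var L W

namespace TermWith

variable {Sg : Signature.{w}} {Var : Type u} {L : Type (max (u + 1) w)}

/-- Renaming of free variables. -/
def rename : {W : Type u} → TermWith Sg Var L W → {W' : Type u} → (W → W') → TermWith Sg Var L W'
  | _, var x, _, g => var (g x)
  | _, const l, _, _ => const l
  | _, op f args, _, g => op f (fun i => (args i).rename g)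
  | _, recur V S X, _, g => recur V (fun Y => (S Y).rename (Sum.map g id)) X

/-- Substitution for free variables. -/
def subst : {W : Type u} → TermWith Sg Var L W → {W' : Type u} → (W → TermWith Sg Var L W') →
    TermWith Sg Var L W'
  | _, var x, _, σ => σ x
  | _, const l, _, _ => const l
  | _, op f args, _, σ => op f (fun i => (args i).subst σ)
  | _, recur V S X, _, σ =>
      recur V (fun Y => (S Y).subst
        (Sum.elim (fun x => (σ x).rename Sum.inl) (fun Z => var (Sum.inr Z)))) X

/-- The right-hand side of `X` with `⟨Y | S⟩` substituted for each recursion variable `Y`. -/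
def unfold {W : Type u} (V : Set Var) (S : V → TermWith Sg Var L (W ⊕ V)) (X : V) :
    TermWith Sg Var L W :=
  (S X).subst (Sum.elim var (fun Y => recur V S Y))

/-- Replace each constant `l` by the closed term `e l`. -/
def eval (e : L → ClosedTerm Sg Var) : {W : Type u} → TermWith Sg Var L W → Term Sg Var W
  | _, var x => Term.var x
  | _, const l => (e l).rename PEmpty.elim
  | _, op f args => Term.op f (fun i => (args i).eval e)
  | _, recur V S X => Term.recur V (fun Y => (S Y).eval e) X

/-- Regard an ordinary term as a term with constants. -/
def ofTerm : {W : Type u} → Term Sg Var W → TermWith Sg Var L W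
  | _, .var x => var x
  | _, .op f args => op f (fun i => ofTerm (args i))
  | _, .recur V S X => recur V (fun Y => ofTerm (S Y)) X

/-- Replace each constant `l` by the constant `g l`. -/
def mapConst {L' : Type (max (u + 1) w)} (g : L → L') :
    {W : Type u} → TermWith Sg Var L W → TermWith Sg Var L' W
  | _, var x => var x
  | _, const l => const (g l)
  | _, op f args => op f (fun i => (args i).mapConst g)
  | _, recur V S X => recur V (fun Y => (S Y).mapConst g) X

theorem eval_mapConst {L' : Type (max (u + 1) w)} (g : L → L') (e : L' → ClosedTerm Sg Var)
    {W : Type u} (t : TermWith Sg Var L W) :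
    (t.mapConst g).eval e = t.eval (fun l => e (g l)) := by
  induction t with
  | var x => rfl
  | const l => rfl
  | op f args ih => simp only [mapConst, eval, ih]
  | recur V S X ih => simp only [mapConst, eval, ih]

theorem eval_ofTerm (e : L → ClosedTerm Sg Var) {W : Type u} (t : Term Sg Var W) :
    (ofTerm t : TermWith Sg Var L W).eval e = t := by
  induction t with
  | var x => rfl
  | op f args ih => simp only [ofTerm, eval, ih]
  | recur V S X ih => simp only [ofTerm, eval, ih]

theorem eval_rename (e : L → ClosedTerm Sg Var) {W : Type u} (t : TermWith Sg Var L W) :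
    ∀ {W' : Type u} (g : W → W'), (t.rename g).eval e = (t.eval e).rename g := by
  induction t with
  | var x => intros; rfl
  | const l =>
    intros
    simp only [rename, eval, Term.rename_rename]
    congr 1; exact Subsingleton.elim _ _
  | op f args ih => intros; simp only [rename, eval, Term.rename, ih]
  | recur V S X ih => intros; simp only [rename, eval, Term.rename, ih]

theorem eval_subst (e : L → ClosedTerm Sg Var) {W : Type u} (t : TermWith Sg Var L W) :
    ∀ {W' : Type u} (σ : W → TermWith Sg Var L W'),
      (t.subst σ).eval e = (t.eval e).subst (fun x => (σ x).eval e) := by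
  induction t with
  | var x => intros; rfl
  | const l =>
    intros
    simp only [subst, eval, Term.subst_rename]
    rw [Term.rename_eq_subst]
    congr 1; exact Subsingleton.elim _ _
  | op f args ih => intros; simp only [subst, eval, Term.subst, ih]
  | recur V S X ih =>
    intros
    simp only [subst, eval, Term.subst, ih]
    congr 1; funext Y; congr 1; funext z
    cases z with
    | inl x => simp only [Sum.elim_inl, eval_rename]
    | inr x => rfl

theorem eval_unfold (e : L → ClosedTerm Sg Var) {W : Type u} (V : Set Var)
    (S : V → TermWith Sg Var L (W ⊕ V)) (X : V) :
    (unfold V S X).eval e = Term.unfold V (fun Y => (S Y).eval e) X := by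
  simp only [unfold, Term.unfold, eval_subst]
  congr 1; funext z; cases z <;> rfl

theorem eval_const_closed (e : L → ClosedTerm Sg Var) (l : L) :
    (const l : TermWith Sg Var L PEmpty.{u + 1}).eval e = e l :=
  Term.rename_closed _ _

end TermWith

/-! ### Least fixed points -/

/-- A monotone map on a chain-complete partial order with a least element has a least
fixed point. -/
theorem Monotone.exists_least_fixedPoint {α : Type*} [PartialOrder α] [OrderBot α]
    (hlub : ∀ C : Set α, C.Nonempty → IsChain (· ≤ ·) C → ∃ u, IsLUB C u) {f : α → α}
    (hf : Monotone f) : ∃ x, f x = x ∧ ∀ y, f y ≤ y → x ≤ y := by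
  -- The post-fixed points lying below all pre-fixed points are closed under suprema of chains and
  -- under `f`, so a maximal one is fixed, and it is least.
  obtain ⟨m, -, hm⟩ := zorn_le_nonempty₀ {x | x ≤ f x ∧ ∀ y, f y ≤ y → x ≤ y}
    (fun C hC hchain c hc => by
      obtain ⟨u, hu⟩ := hlub C ⟨c, hc⟩ hchain
      exact ⟨u, ⟨hu.2 fun z hz => (hC hz).1.trans (hf (hu.1 hz)),
        fun y hy => hu.2 fun z hz => (hC hz).2 y hy⟩, fun z hz => hu.1 hz⟩)
    ⊥ ⟨bot_le, fun _ _ => bot_le⟩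
  have hfm : f m ≤ m := hm.2 ⟨hf hm.1.1, fun y hy => (hf (hm.1.2 y hy)).trans hy⟩ hm.1.1
  exact ⟨m, le_antisymm hfm hm.1.1, hm.1.2⟩

/-! ### Pair constants and the information order -/

/-- The pairs of closed terms related by `B`, used as constants. -/
abbrev PairConst {Sg : Signature.{w}} {Var : Type u}
    (B : ClosedTerm Sg Var → ClosedTerm Sg Var → Prop) : Type (max (u + 1) w) :=
  {x : ClosedTerm Sg Var × ClosedTerm Sg Var // B x.1 x.2}

namespace TermWith

variable {Sg : Signature.{w}} {Var : Type u}
  {B : ClosedTerm Sg Var → ClosedTerm Sg Var → Prop}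

/-- Replace each constant `(p, q)` by `p`. -/
def left {W : Type u} (t : TermWith Sg Var (PairConst B) W) : Term Sg Var W :=
  t.eval (fun l => l.1.1)

/-- Replace each constant `(p, q)` by `q`. -/
def right {W : Type u} (t : TermWith Sg Var (PairConst B) W) : Term Sg Var W :=
  t.eval (fun l => l.1.2)

/-- The information order: a constant `(p, p)` carries no information, and lies below every term
`t` with `t.left = p`. -/
def Le : {W : Type u} → TermWith Sg Var (PairConst B) W → TermWith Sg Var (PairConst B) W → Prop
  | _, var x, t' => t' = var x
  | _, const l, t' => t' = const l ∨ (l.1.1 = l.1.2 ∧ t'.left = l.1.1.rename PEmpty.elim)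
  | _, op f args, t' => ∃ args', t' = op f args' ∧ ∀ i, (args i).Le (args' i)
  | _, recur V S X, t' => ∃ S', t' = recur V S' X ∧ ∀ Y, (S Y).Le (S' Y)

theorem Le.refl {W : Type u} (t : TermWith Sg Var (PairConst B) W) : t.Le t := by
  induction t with
  | var x => rfl
  | const l => exact Or.inl rfl
  | op f args ih => exact ⟨args, rfl, ih⟩
  | recur V S X ih => exact ⟨S, rfl, ih⟩

instance {W : Type u} : Std.Refl (Le (B := B) (W := W)) := ⟨Le.refl⟩

theorem Le.left_eq {W : Type u} {t : TermWith Sg Var (PairConst B) W} :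
    ∀ {t' : TermWith Sg Var (PairConst B) W}, t.Le t' → t'.left = t.left := by
  induction t with
  | var x => rintro _ rfl; rfl
  | const l =>
    rintro t' (rfl | ⟨-, h⟩)
    · rfl
    · exact h
  | op f args ih =>
    rintro _ ⟨args', rfl, h⟩
    exact congrArg (Term.op f) (funext fun i => ih i (h i))
  | recur V S X ih =>
    rintro _ ⟨S', rfl, h⟩
    exact congrArg (fun S => Term.recur V S X) (funext fun Y => ih Y (h Y))

theorem Le.trans {W : Type u} {t : TermWith Sg Var (PairConst B) W} :
    ∀ {t' t'' : TermWith Sg Var (PairConst B) W}, t.Le t' → t'.Le t'' → t.Le t'' := by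
  induction t with
  | var x => rintro _ _ rfl h; exact h
  | const l =>
    rintro t' t'' (rfl | ⟨h1, h2⟩) h
    · exact h
    · exact Or.inr ⟨h1, h.left_eq.trans h2⟩
  | op f args ih =>
    rintro _ _ ⟨args', rfl, h⟩ ⟨args'', rfl, h'⟩
    exact ⟨args'', rfl, fun i => ih i (h i) (h' i)⟩
  | recur V S X ih =>
    rintro _ _ ⟨S', rfl, h⟩ ⟨S'', rfl, h'⟩
    exact ⟨S'', rfl, fun i => ih i (h i) (h' i)⟩

theorem Le.antisymm {W : Type u} {t : TermWith Sg Var (PairConst B) W} :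
    ∀ {t' : TermWith Sg Var (PairConst B) W}, t.Le t' → t'.Le t → t = t' := by
  induction t with
  | var x => rintro _ rfl _; rfl
  | const l =>
    rintro t' (rfl | ⟨h1, h2⟩) h
    · rfl
    · cases t' with
      | var x => cases h
      | op f args => obtain ⟨_, h, _⟩ := h; cases h
      | recur V S X => obtain ⟨_, h, _⟩ := h; cases h
      | const l' =>
        rcases h with h | ⟨h3, -⟩
        · exact h
        -- Both constants are diagonal and have the same left evaluation, hence coincide.
        · have h4 : l'.1.1 = l.1.1 := Term.rename_closed_injective h2
          congr 1
          exact Subtype.ext (Prod.ext h4.symm (h1.symm.trans (h4.symm.trans h3)))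
  | op f args ih =>
    rintro _ ⟨args', rfl, h⟩ ⟨args'', h', h''⟩
    cases h'
    exact congrArg (op f) (funext fun i => ih i (h i) (h'' i))
  | recur V S X ih =>
    rintro _ ⟨S', rfl, h⟩ ⟨S'', h', h''⟩
    cases h'
    exact congrArg (fun S => recur V S X) (funext fun i => ih i (h i) (h'' i))

theorem Le.rename {W : Type u} {t : TermWith Sg Var (PairConst B) W} :
    ∀ {t' : TermWith Sg Var (PairConst B) W} {W' : Type u} (g : W → W'), t.Le t' →
      (t.rename g).Le (t'.rename g) := by
  induction t with
  | var x => rintro _ _ g rfl; rfl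
  | const l =>
    rintro t' _ g (rfl | ⟨h1, h2⟩)
    · exact Or.inl rfl
    · refine Or.inr ⟨h1, ?_⟩
      unfold left at h2 ⊢
      rw [eval_rename, h2, Term.rename_rename]
      congr 1; exact Subsingleton.elim _ _
  | op f args ih =>
    rintro _ _ g ⟨args', rfl, h⟩
    exact ⟨_, rfl, fun i => ih i g (h i)⟩
  | recur V S X ih =>
    rintro _ _ g ⟨S', rfl, h⟩
    exact ⟨_, rfl, fun i => ih i _ (h i)⟩

theorem Le.subst {W : Type u} {t : TermWith Sg Var (PairConst B) W} :
    ∀ {t' : TermWith Sg Var (PairConst B) W} {W' : Type u}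
      {σ σ' : W → TermWith Sg Var (PairConst B) W'}, t.Le t' → (∀ x, (σ x).Le (σ' x)) →
      (t.subst σ).Le (t'.subst σ') := by
  induction t with
  | var x => rintro _ _ _ _ rfl h; exact h x
  | const l =>
    rintro t' _ _ _ (rfl | ⟨h1, h2⟩) _
    · exact Or.inl rfl
    · refine Or.inr ⟨h1, ?_⟩
      unfold left at h2 ⊢
      rw [eval_subst, h2, Term.subst_rename, Term.rename_eq_subst]
      congr 1; exact Subsingleton.elim _ _
  | op f args ih =>
    rintro _ _ _ _ ⟨args', rfl, h⟩ hσ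
    exact ⟨_, rfl, fun i => ih i (h i) hσ⟩
  | recur V S X ih =>
    rintro _ _ _ _ ⟨S', rfl, h⟩ hσ
    refine ⟨_, rfl, fun i => ih i (h i) ?_⟩
    rintro (x | x)
    · exact (hσ x).rename _
    · exact Le.refl _

theorem Le.unfold {W : Type u} {V : Set Var} {S S' : V → TermWith Sg Var (PairConst B) (W ⊕ V)}
    (h : ∀ Y, (S Y).Le (S' Y)) (X : V) : (unfold V S X).Le (unfold V S' X) := by
  refine (h X).subst ?_
  rintro (x | x)
  · exact Le.refl _
  · exact ⟨S', rfl, h⟩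

/-- Among the terms with a given left evaluation, each nonempty chain has a least upper bound. -/
theorem Le.exists_lub {W : Type u} (p : Term Sg Var W) :
    ∀ C : Set (TermWith Sg Var (PairConst B) W), C.Nonempty → (∀ c ∈ C, c.left = p) →
      IsChain Le C →
      ∃ u, u.left = p ∧ (∀ c ∈ C, c.Le u) ∧ ∀ v, (∀ c ∈ C, c.Le v) → u.Le v := by
  have greatest : ∀ {W : Type u} (p : Term Sg Var W)
      (C : Set (TermWith Sg Var (PairConst B) W)), (∀ c ∈ C, c.left = p) →
      (∃ g ∈ C, ∀ c ∈ C, c.Le g) →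
      ∃ u, u.left = p ∧ (∀ c ∈ C, c.Le u) ∧ ∀ v, (∀ c ∈ C, c.Le v) → u.Le v :=
    fun p C hC ⟨g, hg, h⟩ => ⟨g, hC g hg, h, fun v hv => hv g hg⟩
  -- An off-diagonal constant in the chain is its top. If there are only diagonal constants, any
  -- element is a top, since all have the same left evaluation. Otherwise some element is not a
  -- constant, and its head is that of `p`.
  have main : ∀ {W : Type u} (p : Term Sg Var W)
      (C : Set (TermWith Sg Var (PairConst B) W)), C.Nonempty → (∀ c ∈ C, c.left = p) →
      IsChain Le C → (∃ g ∈ C, ∀ c ∈ C, c.Le g) ∨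
        ((∃ c ∈ C, ∀ l, c ≠ const l) ∧ ∀ l, const l ∈ C → l.1.1 = l.1.2) := by
    intro W p C hne hC hchain
    by_cases h : ∃ l, const l ∈ C ∧ l.1.1 ≠ l.1.2
    · obtain ⟨l, hl, hl'⟩ := h
      refine Or.inl ⟨_, hl, fun c hc => ?_⟩
      rcases hchain.total hl hc with (h | h) | h
      · rw [h]; exact Le.refl _
      · exact absurd h.1 hl'
      · exact h
    · push Not at h
      by_cases h' : ∃ c ∈ C, ∀ l, c ≠ const l
      · exact Or.inr ⟨h', h⟩
      · push Not at h'
        obtain ⟨g, hg⟩ := hne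
        refine Or.inl ⟨g, hg, fun c hc => ?_⟩
        obtain ⟨l, rfl⟩ := h' c hc
        exact Or.inr ⟨h l hc, (hC g hg).trans (hC _ hc).symm⟩
  induction p with
  | var x =>
    intro C hne hC hchain
    rcases main _ C hne hC hchain with h | ⟨⟨c, hc, hc'⟩, hl⟩
    · exact greatest _ C hC h
    · refine greatest _ C hC ⟨c, hc, fun d hd => ?_⟩
      have hleft := hC d hd
      cases d with
      | var y =>
        cases c with
        | var z =>
          have h1 := hC _ hc
          simp only [left, eval, Term.var.injEq] at h1 hleft
          rw [h1, hleft]; exact Le.refl _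
        | const l => exact absurd rfl (hc' l)
        | op f args => cases hC _ hc
        | recur V S X => cases hC _ hc
      | const l => exact Or.inr ⟨hl l hd, (hC c hc).trans hleft.symm⟩
      | op f args => cases hleft
      | recur V S X => cases hleft
  | op f args ih =>
    intro C hne hC hchain
    rcases main _ C hne hC hchain with h | ⟨⟨c, hc, hc'⟩, hl⟩
    · exact greatest _ C hC h
    · have hform : ∀ d ∈ C, (∃ l, d = const l) ∨
          ∃ args', d = op f args' ∧ ∀ i, (args' i).left = args i := by
        intro d hd
        have hleft := hC d hd
        cases d with
        | var y => cases hleft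
        | const l => exact Or.inl ⟨l, rfl⟩
        | op f args' =>
          simp only [left, eval, Term.op.injEq] at hleft
          obtain ⟨rfl, hleft⟩ := hleft
          exact Or.inr ⟨args', rfl, fun i => congrFun (eq_of_heq hleft) i⟩
        | recur V S X => cases hleft
      obtain ⟨l, rfl⟩ | ⟨a0, rfl, ha0⟩ := hform c hc
      · exact absurd rfl (hc' l)
      -- The diagonal constants lie below everything in the fiber and are dropped; the remaining
      -- members share the head `f`, and suprema are formed argument by argument.
      have key : ∀ i, ∃ u, u.left = args i ∧
          (∀ d ∈ {d | ∃ a, op f a ∈ C ∧ d = a i}, d.Le u) ∧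
          ∀ v, (∀ d ∈ {d | ∃ a, op f a ∈ C ∧ d = a i}, d.Le v) → u.Le v := by
        intro i
        refine ih i _ ⟨a0 i, a0, hc, rfl⟩ ?_ ?_
        · rintro _ ⟨a, ha, rfl⟩
          rcases hform _ ha with ⟨l, h⟩ | ⟨a', h, h'⟩
          · cases h
          · cases h; exact h' i
        · rintro _ ⟨a, ha, rfl⟩ _ ⟨b, hb, rfl⟩ -
          rcases hchain.total ha hb with ⟨_, h, h'⟩ | ⟨_, h, h'⟩
          · cases h; exact Or.inl (h' i)
          · cases h; exact Or.inr (h' i)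
      choose u hu hub hleast using key
      have hu' : (op f u).left = Term.op f args := congrArg (Term.op f) (funext hu)
      refine ⟨op f u, hu', fun d hd => ?_, fun v hv => ?_⟩
      · rcases hform d hd with ⟨l, rfl⟩ | ⟨a, rfl, -⟩
        · exact Or.inr ⟨hl l hd, hu'.trans (hC _ hd).symm⟩
        · exact ⟨u, rfl, fun i => hub i _ ⟨a, hd, rfl⟩⟩
      -- An upper bound lies above the non-constant member `c`, which forces its head symbol.
      · obtain ⟨v', rfl, -⟩ := hv _ hc
        refine ⟨v', rfl, fun i => hleast i _ ?_⟩
        rintro _ ⟨a, ha, rfl⟩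
        obtain ⟨_, h, h'⟩ := hv _ ha
        cases h; exact h' i
  | recur V S X ih =>
    intro C hne hC hchain
    rcases main _ C hne hC hchain with h | ⟨⟨c, hc, hc'⟩, hl⟩
    · exact greatest _ C hC h
    · have hform : ∀ d ∈ C, (∃ l, d = const l) ∨
          ∃ S', d = recur V S' X ∧ ∀ i, (S' i).left = S i := by
        intro d hd
        have hleft := hC d hd
        cases d with
        | var y => cases hleft
        | const l => exact Or.inl ⟨l, rfl⟩
        | op f args' => cases hleft
        | recur V S' X =>
          simp only [left, eval, Term.recur.injEq] at hleft
          obtain ⟨rfl, hS, hX⟩ := hleft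
          obtain rfl := eq_of_heq hX
          exact Or.inr ⟨S', rfl, fun i => congrFun (eq_of_heq hS) i⟩
      obtain ⟨l, rfl⟩ | ⟨a0, rfl, ha0⟩ := hform c hc
      · exact absurd rfl (hc' l)
      have key : ∀ i, ∃ u, u.left = S i ∧
          (∀ d ∈ {d | ∃ a, recur V a X ∈ C ∧ d = a i}, d.Le u) ∧
          ∀ v, (∀ d ∈ {d | ∃ a, recur V a X ∈ C ∧ d = a i}, d.Le v) → u.Le v := by
        intro i
        refine ih i _ ⟨a0 i, a0, hc, rfl⟩ ?_ ?_
        · rintro _ ⟨a, ha, rfl⟩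
          rcases hform _ ha with ⟨l, h⟩ | ⟨a', h, h'⟩
          · cases h
          · cases h; exact h' i
        · rintro _ ⟨a, ha, rfl⟩ _ ⟨b, hb, rfl⟩ -
          rcases hchain.total ha hb with ⟨_, h, h'⟩ | ⟨_, h, h'⟩
          · cases h; exact Or.inl (h' i)
          · cases h; exact Or.inr (h' i)
      choose u hu hub hleast using key
      have hu' : (recur V u X).left = Term.recur V S X :=
        congrArg (fun S => Term.recur V S X) (funext hu)
      refine ⟨recur V u X, hu', fun d hd => ?_, fun v hv => ?_⟩
      · rcases hform d hd with ⟨l, rfl⟩ | ⟨a, rfl, -⟩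
        · exact Or.inr ⟨hl l hd, hu'.trans (hC _ hd).symm⟩
        · exact ⟨u, rfl, fun i => hub i _ ⟨a, hd, rfl⟩⟩
      · obtain ⟨v', rfl, -⟩ := hv _ hc
        refine ⟨v', rfl, fun i => hleast i _ ?_⟩
        rintro _ ⟨a, ha, rfl⟩
        obtain ⟨_, h, h'⟩ := hv _ ha
        cases h; exact h' i

end TermWith

/-! ### Fibers of the left evaluation -/

/-- The closed terms with pairs from `B` as constants whose left evaluation is `p`. -/
@[ext] structure Fiber {Sg : Signature.{w}} {Var : Type u}
    (B : ClosedTerm Sg Var → ClosedTerm Sg Var → Prop) (p : ClosedTerm Sg Var) :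
    Type (max (u + 1) w) where
  val : TermWith Sg Var (PairConst B) PEmpty.{u + 1}
  left_val : val.left = p

namespace Fiber

variable {Sg : Signature.{w}} {Var : Type u}
  {B : ClosedTerm Sg Var → ClosedTerm Sg Var → Prop}

instance (p : ClosedTerm Sg Var) : PartialOrder (Fiber B p) where
  le t t' := t.1.Le t'.1
  le_refl t := TermWith.Le.refl t.1
  le_trans _ _ _ h h' := TermWith.Le.trans h h'
  le_antisymm _ _ h h' := Fiber.ext (TermWith.Le.antisymm h h')

instance [Std.Refl B] (p : ClosedTerm Sg Var) : OrderBot (Fiber B p) where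
  bot := ⟨TermWith.const ⟨(p, p), refl p⟩, TermWith.eval_const_closed _ _⟩
  bot_le t := Or.inr ⟨rfl, t.2.trans (Term.rename_closed _ _).symm⟩

/-- Suprema are pointwise, as a chain in the product projects to a chain in each fiber. -/
theorem exists_isLUB {ι : Type*} {σ : ι → ClosedTerm Sg Var} (C : Set (∀ i, Fiber B (σ i)))
    (hne : C.Nonempty) (hC : IsChain (· ≤ ·) C) : ∃ u, IsLUB C u := by
  have key : ∀ i, ∃ u : Fiber B (σ i), (∀ c ∈ C, c i ≤ u) ∧ ∀ v, (∀ c ∈ C, c i ≤ v) → u ≤ v := by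
    intro i
    obtain ⟨u, hu, hub, hleast⟩ := TermWith.Le.exists_lub (σ i) ((fun c => (c i).1) '' C)
      (hne.image _) (by rintro _ ⟨c, -, rfl⟩; exact (c i).2)
      (by
        rintro _ ⟨c, hc, rfl⟩ _ ⟨d, hd, rfl⟩ -
        exact (hC.total hc hd).imp (fun h => h i) (fun h => h i))
    refine ⟨⟨u, hu⟩, fun c hc => hub _ ⟨c, hc, rfl⟩, fun v hv => hleast _ ?_⟩
    rintro _ ⟨c, hc, rfl⟩
    exact hv c hc
  choose u hub hleast using key
  exact ⟨u, fun c hc i => hub i c hc, fun v hv i => hleast i _ fun c hc => hv hc i⟩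

/-- The value of an ordinary term under a substitution of elements of fibers. -/
def inst {σ : Var → ClosedTerm Sg Var} (s : Term Sg Var Var) (τ : ∀ x, Fiber B (σ x)) :
    Fiber B (s.subst σ) :=
  ⟨(TermWith.ofTerm s).subst (fun x => (τ x).1), by
    unfold TermWith.left
    rw [TermWith.eval_subst, TermWith.eval_ofTerm]
    congr 1; funext x; exact (τ x).2⟩

theorem inst_mono {σ : Var → ClosedTerm Sg Var} (s : Term Sg Var Var) :
    Monotone (inst (B := B) (σ := σ) s) :=
  fun _ _ h => (TermWith.Le.refl _).subst h

theorem right_inst {σ : Var → ClosedTerm Sg Var} (s : Term Sg Var Var)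
    (τ : ∀ x, Fiber B (σ x)) : (inst s τ).1.right = s.subst (fun x => (τ x).1.right) := by
  unfold TermWith.right inst
  rw [TermWith.eval_subst, TermWith.eval_ofTerm]

end Fiber

/-! ### Proofs with closed literals only -/

namespace Literal

variable {Sg : Signature.{w}} {Var : Type u} {A : Type v}

theorem subst_subst {W W' W'' : Type u} (l : Literal Sg Var A W) (σ : W → Term Sg Var W')
    (τ : W' → Term Sg Var W'') : (l.subst σ).subst τ = l.subst (fun x => (σ x).subst τ) := by
  cases l <;> simp only [subst, Term.subst_subst]

theorem subst_closed (l : Literal Sg Var A PEmpty.{u + 1})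
    (σ : PEmpty.{u + 1} → ClosedTerm Sg Var) : l.subst σ = l := by
  cases l <;> simp only [subst, Term.subst_closed]

end Literal

namespace TSS

variable {Sg : Signature.{w}} {Var : Type u} {A : Type v}

/-- Provability of closed literals by proofs that contain closed literals only. -/
inductive ClosedProvable (P : TSS Sg Var A) (N : Set (Literal Sg Var A PEmpty.{u + 1})) :
    Literal Sg Var A PEmpty.{u + 1} → Prop
  | hyp {β : Literal Sg Var A PEmpty.{u + 1}} : β ∈ N → ClosedProvable P N β
  | rule {r : Rule Sg Var A} (hr : r ∈ P.rules) (σ : Var → ClosedTerm Sg Var) :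
      (∀ l ∈ r.premises, ClosedProvable P N (l.subst σ)) →
        ClosedProvable P N (r.conclusion.subst σ)

variable {P : TSS Sg Var A} {N N' : Set (Literal Sg Var A PEmpty.{u + 1})}

theorem ClosedProvable.mono (hN : N ⊆ N') {l : Literal Sg Var A PEmpty.{u + 1}}
    (h : P.ClosedProvable N l) : P.ClosedProvable N' l := by
  induction h with
  | hyp h => exact .hyp (hN h)
  | rule hr σ _ ih => exact .rule hr σ ih

/-- A closed substitution can be pushed through a whole proof, because the hypotheses are closed and
stay as they are. -/
theorem Provable.closedProvable {l : Literal Sg Var A Var}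
    (h : P.Provable (Literal.ofClosed '' N) l) (τ : Var → ClosedTerm Sg Var) :
    P.ClosedProvable N (l.subst τ) := by
  induction h with
  | hyp h =>
    obtain ⟨l, hl, rfl⟩ := h
    rw [Literal.ofClosed, Literal.subst_subst, Literal.subst_closed]
    exact .hyp hl
  | rule hr σ _ ih =>
    rw [Literal.subst_subst]
    refine .rule hr _ fun l hl => ?_
    rw [← Literal.subst_subst]
    exact ih l hl

theorem ClosedProvable.provable {l : Literal Sg Var A PEmpty.{u + 1}}
    (h : P.ClosedProvable N l) : P.Provable (Literal.ofClosed '' N) l.ofClosed := by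
  induction h with
  | hyp h => exact .hyp ⟨_, h, rfl⟩
  | rule hr σ _ ih =>
    rw [Literal.ofClosed, Literal.subst_subst]
    refine .rule hr _ fun l hl => ?_
    rw [← Literal.subst_subst]
    exact ih l hl

theorem pos_mem_consequences {p q : ClosedTerm Sg Var} {a : A} :
    Literal.pos p a q ∈ P.consequences N ↔ P.ClosedProvable N (.pos p a q) := by
  refine ⟨fun h => ?_, fun h => ⟨trivial, h.provable⟩⟩
  have := h.2.closedProvable (fun _ => p)
  rwa [Literal.ofClosed, Literal.subst_subst, Literal.subst_closed] at this

theorem ClosedProvable.recursion (hP : P.IsNtyftNtyxtWithRecursion) {V : Set Var}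
    {S : V → Term Sg Var (PEmpty.{u + 1} ⊕ V)} {X : V} {a : A} {q : ClosedTerm Sg Var}
    (h : P.ClosedProvable N (.pos (Term.unfold V S X) a q)) :
    P.ClosedProvable N (.pos (Term.recur V S X) a q) := by
  obtain ⟨z, hz⟩ := hP.1 V (fun Y => (S Y).rename (Sum.map PEmpty.elim id)) X a
  have hS : (fun Y => ((S Y).rename (Sum.map PEmpty.elim id)).subst
      (Sum.elim (fun _ : Var => q.rename Sum.inl) (fun Z => Term.var (Sum.inr Z)))) = S := by
    funext Y
    rw [Term.subst_rename]
    conv_rhs => rw [← Term.subst_var (S Y)]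
    congr 1; funext x
    rcases x with x | x
    · exact x.elim
    · rfl
  -- The specification has no free variables, so only the value at `z` matters, and it has to be
  -- `q`.
  have := ClosedProvable.rule (N := N) hz (fun _ => q) (by
    rintro _ rfl
    simp only [Literal.subst, Term.subst_unfold, hS]
    exact h)
  simpa only [Literal.subst, Rule.conclusion, Rule.recursion, Term.subst, hS] using this

end TSS

/-! ### Monotone lifting of transitions -/

/-- A monotone way to lift the transition `p -a→ p'` to the right evaluations of the terms with
left evaluation `p`. -/
def Liftable {Sg : Signature.{w}} {Var : Type u} {A : Type v} (P : TSS Sg Var A)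
    (N : Set (Literal Sg Var A PEmpty.{u + 1}))
    (B : ClosedTerm Sg Var → ClosedTerm Sg Var → Prop)
    (p : ClosedTerm Sg Var) (a : A) (p' : ClosedTerm Sg Var) : Prop :=
  ∃ Φ : Fiber B p → Fiber B p', Monotone Φ ∧
    ∀ t, P.ClosedProvable N (.pos t.1.right a (Φ t).1.right)

namespace Fiber

variable {Sg : Signature.{w}} {Var : Type u} {A : Type v}
  {B : ClosedTerm Sg Var → ClosedTerm Sg Var → Prop}

/-- The term is not a single constant. -/
def Proper {p : ClosedTerm Sg Var} (t : Fiber B p) : Prop := ∀ l, t.1 ≠ .const l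

/-- Only constants lie below a constant; hence a map given on proper terms can be extended to
constants without upsetting monotonicity. -/
theorem Proper.of_le {p : ClosedTerm Sg Var} {t t' : Fiber B p} (h : t.Proper) (hle : t ≤ t') :
    t'.Proper := by
  rintro l hl
  obtain ⟨t, ht⟩ := t
  obtain ⟨_, ht'⟩ := t'
  subst hl
  change t.Le _ at hle
  cases t with
  | var x => exact x.elim
  | const l => exact h l rfl
  | op f args => obtain ⟨_, h, -⟩ := hle; cases h
  | recur V S X => obtain ⟨_, h, -⟩ := hle; cases h

/-- Constants need no rule. A diagonal one keeps the original transition and is sent to `⊥`, below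
every other value. An off-diagonal `(p, q)` is sent to a pair `(p', q')` obtained from `hB`; being
maximal, it imposes no condition on this choice. -/
theorem liftable_of_proper [Std.Refl B] {P : TSS Sg Var A}
    {N N' : Set (Literal Sg Var A PEmpty.{u + 1})} (hN : N ⊆ N')
    (hB : ∀ p q a p', B p q → P.ClosedProvable N (.pos p a p') →
      ∃ q', P.ClosedProvable N' (.pos q a q') ∧ B p' q')
    {p p' : ClosedTerm Sg Var} {a : A} (h : P.ClosedProvable N (.pos p a p'))
    (Ψ : ∀ t : Fiber B p, t.Proper → Fiber B p')
    (hΨ : ∀ t t' ht ht', t ≤ t' → Ψ t ht ≤ Ψ t' ht')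
    (hprov : ∀ t ht, P.ClosedProvable N' (.pos t.1.right a (Ψ t ht).1.right)) :
    Liftable P N' B p a p' := by
  have key : ∀ t : Fiber B p, ∃ u : Fiber B p',
      P.ClosedProvable N' (.pos t.1.right a u.1.right) ∧
      (∀ ht : t.Proper, u = Ψ t ht) ∧
      (∀ l : PairConst B, t.1 = .const l → l.1.1 = l.1.2 → u = ⊥) := by
    intro t
    by_cases ht : t.Proper
    · exact ⟨Ψ t ht, hprov t ht, fun _ => rfl, fun l hl => absurd hl (ht l)⟩
    obtain ⟨l, hl⟩ : ∃ l, t.1 = .const l := by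
      unfold Proper at ht
      push Not at ht
      exact ht
    have hl1 : l.1.1 = p := by
      rw [← t.2, hl]; exact (TermWith.eval_const_closed _ _).symm
    have hl2 : t.1.right = l.1.2 := by
      rw [hl]; exact TermWith.eval_const_closed _ _
    by_cases hll : l.1.1 = l.1.2
    · refine ⟨⊥, ?_, fun h => absurd h ht, fun _ _ _ => rfl⟩
      have : (⊥ : Fiber B p').1.right = p' := TermWith.eval_const_closed _ _
      rw [this, hl2, ← hll, hl1]
      exact h.mono hN
    · obtain ⟨q', hq', hB'⟩ := hB l.1.1 l.1.2 a p' l.2 (hl1 ▸ h)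
      refine ⟨⟨.const ⟨(p', q'), hB'⟩, TermWith.eval_const_closed _ _⟩, ?_,
        fun h => absurd h ht, fun l' hl' h => ?_⟩
      · rw [hl2]
        have : (TermWith.const (W := PEmpty.{u + 1}) (Sg := Sg) (Var := Var)
          (⟨(p', q'), hB'⟩ : PairConst B)).right = q' := TermWith.eval_const_closed _ _
        rw [this]
        exact hq'
      · rw [hl] at hl'
        cases hl'
        exact absurd h hll
  choose Φ hΦ hproper hbot using key
  refine ⟨Φ, fun t t' hle => ?_, hΦ⟩
  by_cases ht : t.Proper
  · rw [hproper t ht, hproper t' (ht.of_le hle)]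
    exact hΨ _ _ _ _ hle
  · obtain ⟨l, hl⟩ : ∃ l, t.1 = .const l := by
      unfold Proper at ht
      push Not at ht
      exact ht
    have hle' : t.1.Le t'.1 := hle
    rw [hl] at hle'
    rcases hle' with h | ⟨h, -⟩
    · rw [show t' = t from Fiber.ext (h.trans hl.symm)]
    · rw [hbot t l hl h]; exact bot_le

end Fiber

/-- The terms that may be the source of an ntyft or ntyxt rule. -/
def Term.IsSimple {Sg : Signature.{w}} {Var : Type u} (s : Term Sg Var Var) : Prop :=
  (∃ (f : Sg.Sym) (x : Fin (Sg.arity f) → Var),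
    Function.Injective x ∧ s = .op f (fun i => .var (x i))) ∨ ∃ x, s = .var x

namespace Fiber

variable {Sg : Signature.{w}} {Var : Type u} {A : Type v}
  {B : ClosedTerm Sg Var → ClosedTerm Sg Var → Prop} {σ : Var → ClosedTerm Sg Var}

theorem inst_congr {s : Term Sg Var Var} (hs : s.IsSimple) {τ τ' : ∀ x, Fiber B (σ x)}
    (h : ∀ x ∈ s.vars, τ x = τ' x) : inst s τ = inst s τ' := by
  apply Fiber.ext
  rcases hs with ⟨f, x, -, rfl⟩ | ⟨x, rfl⟩
  · refine congrArg (TermWith.op f) (funext fun i => ?_)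
    exact congrArg Fiber.val (h (x i) ⟨i, rfl⟩)
  · exact congrArg Fiber.val (h x rfl)

theorem le_of_inst_le {s : Term Sg Var Var} (hs : s.IsSimple) {τ τ' : ∀ x, Fiber B (σ x)}
    (h : inst s τ ≤ inst s τ') : ∀ x ∈ s.vars, τ x ≤ τ' x := by
  rcases hs with ⟨f, x, -, rfl⟩ | ⟨x, rfl⟩
  · obtain ⟨args, h1, h2⟩ := h
    cases h1
    rintro _ ⟨i, rfl⟩
    exact h2 i
  · rintro _ rfl
    exact h

/-- Matching of a non-constant term against the source of a rule: its head is visible, and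
distinctness of the `x i` makes the assignment well defined. Variables outside the source get `⊥`.
-/
theorem exists_inst_eq [Std.Refl B] {s : Term Sg Var Var} (hs : s.IsSimple)
    {t : Fiber B (s.subst σ)} (ht : t.Proper) : ∃ τ : ∀ x, Fiber B (σ x), inst s τ = t := by
  classical
  obtain ⟨t, hleft⟩ := t
  rcases hs with ⟨f, x, hx, rfl⟩ | ⟨x, rfl⟩
  · cases t with
    | var x => exact x.elim
    | const l => exact absurd rfl (ht l)
    | recur V S X => cases hleft
    | op g args =>
      have h := hleft
      simp only [TermWith.left, TermWith.eval, Term.subst, Term.op.injEq] at h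
      obtain ⟨rfl, h⟩ := h
      have h' : ∀ i, (args i).left = σ (x i) := fun i => congrFun (eq_of_heq h) i
      refine ⟨fun y => if hy : ∃ i, x i = y then ⟨args hy.choose, by
        rw [h', hy.choose_spec]⟩ else ⊥, Fiber.ext ?_⟩
      refine congrArg (TermWith.op g) (funext fun i => ?_)
      have hi : ∃ j, x j = x i := ⟨i, rfl⟩
      refine (congrArg Fiber.val (dif_pos hi)).trans ?_
      exact congrArg args (hx hi.choose_spec)
  · refine ⟨fun y => if hy : x = y then ⟨t, hy ▸ hleft⟩ else ⊥, Fiber.ext ?_⟩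
    exact congrArg Fiber.val (dif_pos rfl)

end Fiber

namespace TSS

variable {Sg : Signature.{w}} {Var : Type u} {A : Type v} {P : TSS Sg Var A}
  {B : ClosedTerm Sg Var → ClosedTerm Sg Var → Prop}
  {N N' : Set (Literal Sg Var A PEmpty.{u + 1})}

/-- Matching against the source fixes the values of its variables. The other values must agree with
the lifts of the premises, a possibly circular system solved by a least fixed point; the rule is
then applied under the right evaluation of the solution. -/
theorem exists_proper_lift_of_ntytt [Std.Refl B] {r : Rule Sg Var A} (hr : r ∈ P.rules)
    (hntytt : r.IsNtytt) (hs : r.source.IsSimple) {σ : Var → ClosedTerm Sg Var}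
    (hpos : ∀ s b y, .pos s b (.var y) ∈ r.premises →
      Liftable P N' B (s.subst σ) b (σ y))
    (hneg : ∀ s b, .neg s b ∈ r.premises → ∀ t : Fiber B (s.subst σ),
      .neg t.1.right b ∈ N') :
    ∃ Ψ : ∀ t : Fiber B (r.source.subst σ), t.Proper → Fiber B (r.target.subst σ),
      (∀ t t' ht ht', t ≤ t' → Ψ t ht ≤ Ψ t' ht') ∧
      ∀ t ht, P.ClosedProvable N' (.pos t.1.right r.label (Ψ t ht).1.right) := by
  classical
  have hG : ∀ y, ∃ G : (∀ x, Fiber B (σ x)) → Fiber B (σ y), Monotone G ∧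
      ∀ s b, .pos s b (.var y) ∈ r.premises → ∀ τ,
        P.ClosedProvable N' (.pos (Fiber.inst s τ).1.right b (G τ).1.right) := by
    intro y
    by_cases h : ∃ s b, .pos s b (.var y) ∈ r.premises
    · obtain ⟨s, b, h⟩ := h
      obtain ⟨Φ, hΦ, hΦ'⟩ := hpos s b y h
      refine ⟨fun τ => Φ (Fiber.inst s τ), hΦ.comp (Fiber.inst_mono s), fun s' b' h' τ => ?_⟩
      -- At most one positive premise has right-hand side `y`, so one map `G` per variable suffices.
      obtain ⟨rfl, rfl⟩ := hntytt.2 _ _ _ _ _ h h'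
      exact hΦ' _
    · exact ⟨fun _ => ⊥, fun _ _ _ => le_rfl, fun s b h' => absurd ⟨s, b, h'⟩ h⟩
  choose G hGmono hGprov using hG
  let F : (∀ x, Fiber B (σ x)) → (∀ x, Fiber B (σ x)) → ∀ x, Fiber B (σ x) :=
    fun m τ x => if x ∈ r.source.vars then m x else G x τ
  have hF : ∀ m, Monotone (F m) := by
    intro m τ τ' h x
    by_cases hx : x ∈ r.source.vars
    · simp only [F, if_pos hx]; exact le_rfl
    · simp only [F, if_neg hx]; exact hGmono x h
  choose T hT hTleast using fun m => (hF m).exists_least_fixedPoint Fiber.exists_isLUB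
  choose m hm using fun (t : Fiber B (r.source.subst σ)) (ht : t.Proper) =>
    Fiber.exists_inst_eq hs ht
  refine ⟨fun t ht => Fiber.inst r.target (T (m t ht)), fun t t' ht ht' hle => ?_,
    fun t ht => ?_⟩
  -- The solution for the larger term is a pre-fixed point of the operator for the smaller one,
  -- hence above its least fixed point.
  · refine Fiber.inst_mono _ (hTleast _ _ fun x => ?_)
    conv_rhs => rw [← hT]
    by_cases hx : x ∈ r.source.vars
    · simp only [F, if_pos hx]
      refine Fiber.le_of_inst_le hs ?_ x hx
      rw [hm, hm]; exact hle
    · simp only [F, if_neg hx]; exact le_rfl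
  · have hsource : Fiber.inst r.source (T (m t ht)) = t := by
      conv_rhs => rw [← hm t ht]
      refine Fiber.inst_congr hs fun x hx => ?_
      rw [← hT]; simp only [F, if_pos hx]
    have := ClosedProvable.rule (N := N') hr (fun x => (T (m t ht) x).1.right) (by
      rintro (⟨s, b, t'⟩ | ⟨s, b⟩) hl
      · obtain ⟨y, rfl, hy⟩ := hntytt.1 _ _ _ hl
        have h := hGprov y s b hl (T (m t ht))
        rw [Fiber.right_inst] at h
        have h' : G y (T (m t ht)) = T (m t ht) y := by
          conv_rhs => rw [← hT]
          simp only [F, if_neg hy]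
        rw [h'] at h
        exact h
      · have h := hneg s b hl (Fiber.inst s (T (m t ht)))
        rw [Fiber.right_inst] at h
        exact .hyp h)
    have htarget := Fiber.right_inst r.target (T (m t ht))
    have hsource' := Fiber.right_inst r.source (T (m t ht))
    rw [hsource] at hsource'
    rw [htarget, hsource']
    exact this

/-- A non-constant term over ⟨X|S⟩ is itself a recursion construct. Unfolding it is monotone and
commutes with both evaluations, so the lift of the premise can be applied to the unfolded term. -/
theorem exists_proper_lift_of_unfold (hP : P.IsNtyftNtyxtWithRecursion) {V : Set Var}
    {S : V → Term Sg Var (PEmpty.{u + 1} ⊕ V)} {X : V} {a : A} {q : ClosedTerm Sg Var}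
    (h : Liftable P N' B (Term.unfold V S X) a q) :
    ∃ Ψ : ∀ t : Fiber B (Term.recur V S X), t.Proper → Fiber B q,
      (∀ t t' ht ht', t ≤ t' → Ψ t ht ≤ Ψ t' ht') ∧
      ∀ t ht, P.ClosedProvable N' (.pos t.1.right a (Ψ t ht).1.right) := by
  obtain ⟨Φ, hΦ, hΦ'⟩ := h
  have hform : ∀ t : Fiber B (Term.recur V S X), t.Proper →
      ∃ S', t.1 = .recur V S' X ∧ (TermWith.unfold V S' X).left = Term.unfold V S X := by
    rintro ⟨t, hleft⟩ ht
    cases t with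
    | var x => exact x.elim
    | const l => exact absurd rfl (ht l)
    | op f args => cases hleft
    | recur V S' X =>
      simp only [TermWith.left, TermWith.eval, Term.recur.injEq] at hleft
      obtain ⟨rfl, hS, hX⟩ := hleft
      obtain rfl := eq_of_heq hX
      obtain rfl := eq_of_heq hS
      exact ⟨S', rfl, TermWith.eval_unfold _ _ _ _⟩
  choose S' hS' hleft using hform
  refine ⟨fun t ht => Φ ⟨_, hleft t ht⟩, fun t t' ht ht' hle => hΦ ?_, fun t ht => ?_⟩
  · refine TermWith.Le.unfold ?_ X
    obtain ⟨S'', h1, h2⟩ : (TermWith.recur V (S' t ht) X).Le (.recur V (S' t' ht') X) := by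
      rw [← hS', ← hS']; exact hle
    cases h1
    exact h2
  · have := hΦ' ⟨_, hleft t ht⟩
    rw [hS' t ht]
    refine ClosedProvable.recursion hP ?_
    rw [← TermWith.eval_unfold]
    exact this

theorem ClosedProvable.liftable [Std.Refl B] (hP : P.IsNtyftNtyxtWithRecursion)
    (hN : ∀ l ∈ N, l.IsNeg) (hNN' : N ⊆ N')
    (hB : ∀ p q a p', B p q → P.ClosedProvable N (.pos p a p') →
      ∃ q', P.ClosedProvable N' (.pos q a q') ∧ B p' q')
    (hneg : ∀ (t : TermWith Sg Var (PairConst B) PEmpty.{u + 1}) a,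
      .neg t.left a ∈ N → .neg t.right a ∈ N')
    {p p' : ClosedTerm Sg Var} {a : A} (h : P.ClosedProvable N (.pos p a p')) :
    Liftable P N' B p a p' := by
  -- The induction also covers negative literals: rules conclude only positive ones, so a provable
  -- negative premise must belong to `N`.
  suffices H : ∀ l, P.ClosedProvable N l →
      (∀ p a p', l = .pos p a p' → Liftable P N' B p a p') ∧
      (∀ p a, l = .neg p a → .neg p a ∈ N) from (H _ h).1 _ _ _ rfl
  clear h
  intro l h
  induction h with
  | hyp h =>
    refine ⟨?_, ?_⟩
    · rintro p a p' rfl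
      exact (hN _ h).elim
    · rintro p a rfl
      exact h
  | @rule r hr σ hprem ih =>
    refine ⟨?_, fun p a h => by cases h⟩
    intro p a p' heq
    cases heq
    have hconcl := ClosedProvable.rule hr σ hprem
    have simple : r.IsNtytt → r.source.IsSimple →
        Liftable P N' B (r.source.subst σ) r.label (r.target.subst σ) := by
      intro hntytt hs
      obtain ⟨Ψ, hΨ, hΨ'⟩ := exists_proper_lift_of_ntytt (N' := N') (B := B) hr hntytt hs
        (fun s b y hl => (ih _ hl).1 _ _ _ rfl) (fun s b hl t => by
          refine hneg _ _ ?_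
          rw [t.2]
          exact (ih _ hl).2 _ _ rfl)
      exact Fiber.liftable_of_proper hNN' hB hconcl Ψ hΨ hΨ'
    rcases hP.2 r hr with ⟨V, S, X, a, z, rfl⟩ | h | h
    · have hlift := (ih _ rfl).1 _ _ _ rfl
      rw [Term.subst_unfold] at hlift
      obtain ⟨Ψ, hΨ, hΨ'⟩ := exists_proper_lift_of_unfold hP hlift
      exact Fiber.liftable_of_proper hNN' hB hconcl Ψ hΨ hΨ'
    · exact simple h.1 (Or.inl h.2)
    · exact simple h.1 (Or.inr h.2)

end TSS

/-! ### The lean closure -/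

/-- Two closed terms are related if the second one arises from the first one by replacing closed
subterms by terms related to them by `B`. -/
def LeanClosure {Sg : Signature.{w}} {Var : Type u}
    (B : ClosedTerm Sg Var → ClosedTerm Sg Var → Prop) (p q : ClosedTerm Sg Var) : Prop :=
  ∃ t : TermWith Sg Var (PairConst B) PEmpty.{u + 1}, t.left = p ∧ t.right = q

namespace LeanClosure

variable {Sg : Signature.{w}} {Var : Type u}
  {B : ClosedTerm Sg Var → ClosedTerm Sg Var → Prop}

/-- This lets the same lifting argument run from right to left, as possible transitions require. -/
theorem swap {p q : ClosedTerm Sg Var} (h : LeanClosure B p q) :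
    LeanClosure (Function.swap B) q p := by
  obtain ⟨t, rfl, rfl⟩ := h
  let g : PairConst B → PairConst (Function.swap B) := fun l => ⟨l.1.swap, l.2⟩
  exact ⟨t.mapConst g, TermWith.eval_mapConst g (fun l => l.1.1) t,
    TermWith.eval_mapConst g (fun l => l.1.2) t⟩

theorem of_subst (t : Term Sg Var Var) {ρ ν : Var → ClosedTerm Sg Var}
    (h : ∀ x, B (ρ x) (ν x)) : LeanClosure B (t.subst ρ) (t.subst ν) := by
  refine ⟨(TermWith.ofTerm t).subst fun x => .const ⟨(ρ x, ν x), h x⟩, ?_, ?_⟩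
  · unfold TermWith.left
    simp only [TermWith.eval_subst, TermWith.eval_ofTerm, TermWith.eval_const_closed]
  · unfold TermWith.right
    simp only [TermWith.eval_subst, TermWith.eval_ofTerm, TermWith.eval_const_closed]

variable {A : Type v} {P : TSS Sg Var A} {N N' : Set (Literal Sg Var A PEmpty.{u + 1})}

theorem exists_transition [Std.Refl B] (hP : P.IsNtyftNtyxtWithRecursion)
    (hN : ∀ l ∈ N, l.IsNeg) (hNN' : N ⊆ N')
    (hB : ∀ p q a p', B p q → P.ClosedProvable N (.pos p a p') →
      ∃ q', P.ClosedProvable N' (.pos q a q') ∧ B p' q')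
    (hneg : ∀ p q a, LeanClosure B p q → .neg p a ∈ N → .neg q a ∈ N')
    {p q p' : ClosedTerm Sg Var} {a : A} (hpq : LeanClosure B p q)
    (h : P.ClosedProvable N (.pos p a p')) :
    ∃ q', P.ClosedProvable N' (.pos q a q') ∧ LeanClosure B p' q' := by
  obtain ⟨t, ht, rfl⟩ := hpq
  obtain ⟨Φ, -, hΦ⟩ := h.liftable hP hN hNN' hB (fun t a => hneg _ _ a ⟨t, rfl, rfl⟩)
  exact ⟨_, hΦ ⟨t, ht⟩, _, (Φ ⟨t, ht⟩).left_val, rfl⟩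

end LeanClosure

/-! ### Stages of the well-founded semantics -/

namespace TSS

variable {Sg : Signature.{w}} {Var : Type u} {A : Type v}

theorem consequences_mono (P : TSS Sg Var A) : Monotone P.consequences := by
  rintro N N' h (⟨p, a, q⟩ | ⟨p, a⟩) hβ
  · exact pos_mem_consequences.2 ((pos_mem_consequences.1 hβ).mono h)
  · exact hβ.1.elim

theorem undenied_antitone :
    Antitone (undenied : Set (Literal Sg Var A PEmpty.{u + 1}) → Set _) :=
  fun _ _ h _ hl => ⟨hl.1, fun β hβ => hl.2 β (h hβ)⟩

theorem ctNeg_mono (P : TSS Sg Var A) : Monotone P.ctNeg :=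
  fun _ _ h => undenied_antitone (P.consequences_mono (P.ptNeg_antitone h))

theorem neg_mem_undenied {C : Set (Literal Sg Var A PEmpty.{u + 1})} {p : ClosedTerm Sg Var}
    {a : A} : .neg p a ∈ undenied C ↔ ∀ q, .pos p a q ∉ C := by
  refine ⟨fun h q hq => h.2 _ hq ⟨rfl, rfl⟩, fun h => ⟨trivial, ?_⟩⟩
  rintro (⟨q, b, q'⟩ | ⟨q, b⟩) hβ hd
  · obtain ⟨rfl, rfl⟩ := hd
    exact h _ hβ
  · exact hd

theorem certain_iff {P : TSS Sg Var A} {p q : ClosedTerm Sg Var} {a : A} :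
    P.Certain p a q ↔ P.ClosedProvable (P.ctNeg P.closureOrdinal) (.pos p a q) := by
  rw [Certain, ctPos_eq, pos_mem_consequences]

theorem possible_iff {P : TSS Sg Var A} {p q : ClosedTerm Sg Var} {a : A} :
    P.Possible p a q ↔ P.ClosedProvable (P.ptNeg P.closureOrdinal) (.pos p a q) := by
  rw [Possible, ptPos, pos_mem_consequences]

/-- By definition PT⁻ at the closure ordinal consults only strictly earlier stages of CT⁺; since it
agrees with its successor stage, it also excludes CT⁺ at the closure ordinal itself. -/
theorem not_certain_of_neg_mem_ptNeg {P : TSS Sg Var A} {p : ClosedTerm Sg Var} {a : A}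
    (h : .neg p a ∈ P.ptNeg P.closureOrdinal) (q : ClosedTerm Sg Var) : ¬ P.Certain p a q := by
  have hc : P.IsClosureOrdinal P.closureOrdinal := Classical.choose_spec _
  rw [← hc _ (Order.lt_succ _), ptNeg, neg_mem_undenied] at h
  exact fun hq => h q ⟨_, Order.lt_succ _, hq⟩

/-- Transitions certain at stage `o` are simulated by certain transitions, and possible transitions
by transitions possible at stage `o`. -/
theorem IsBisimulation.leanClosure_stage {P : TSS Sg Var A} (hP : P.IsNtyftNtyxtWithRecursion)
    {B : ClosedTerm Sg Var → ClosedTerm Sg Var → Prop} [Std.Refl B] (hB : P.IsBisimulation B)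
    (o : Ordinal.{max (u + 1) v w}) : o ≤ P.closureOrdinal →
    (∀ p q a p', LeanClosure B p q → P.ClosedProvable (P.ctNeg o) (.pos p a p') →
      ∃ q', P.Certain q a q' ∧ LeanClosure B p' q') ∧
    (∀ p q a q', LeanClosure B p q → P.Possible q a q' →
      ∃ p', P.ClosedProvable (P.ptNeg o) (.pos p a p') ∧ LeanClosure B p' q') := by
  induction o using WellFoundedLT.induction with
  | ind o ih =>
  intro ho
  have hposs : ∀ p q a q', LeanClosure B p q → P.Possible q a q' →
      ∃ p', P.ClosedProvable (P.ptNeg o) (.pos p a p') ∧ LeanClosure B p' q' := by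
    intro p q a q' hpq hq
    have : Std.Refl (Function.swap B) := ⟨fun p => refl (r := B) p⟩
    obtain ⟨p', hp', hr⟩ := hpq.swap.exists_transition hP (fun l hl => hl.1)
      (P.ptNeg_antitone ho) (fun q p a q' hqp h => by
        obtain ⟨p', hp', hr⟩ := hB.possible p q a q' hqp (possible_iff.2 h)
        exact ⟨p', (possible_iff.1 hp').mono (P.ptNeg_antitone ho), hr⟩)
      -- A transition of `p` certain at an earlier stage would, by the induction hypothesis, give
      -- `q` a certain transition, which the negative literal excludes.
      (fun q p a hqp h => by
        rw [ptNeg, neg_mem_undenied]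
        rintro p' ⟨k, hk, hp'⟩
        rw [ctPos_eq, pos_mem_consequences] at hp'
        obtain ⟨q', hq', -⟩ := (ih k hk (hk.le.trans ho)).1 p q a p' hqp.swap hp'
        exact not_certain_of_neg_mem_ptNeg h q' hq')
      (possible_iff.1 hq)
    exact ⟨p', hp', hr.swap⟩
  refine ⟨fun p q a p' hpq hp => ?_, hposs⟩
  obtain ⟨q', hq', hr⟩ := hpq.exists_transition hP (fun l hl => hl.1)
    (P.ctNeg_mono ho) (fun p q a p' hpq h => by
      obtain ⟨q', hq', hr⟩ := hB.certain p q a p' hpq (certain_iff.2 (h.mono (P.ctNeg_mono ho)))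
      exact ⟨q', certain_iff.1 hq', hr⟩)
    -- A possible transition of `q` would be matched by one of `p` possible at stage `o`, by the
    -- half just proved for the same `o`.
    (fun p q a hpq h => by
      rw [ctNeg, neg_mem_undenied] at h ⊢
      intro q' hq'
      obtain ⟨p', hp', -⟩ := hposs p q a q' hpq hq'
      exact h p' (pos_mem_consequences.2 hp'))
    hp
  exact ⟨q', certain_iff.2 hq', hr⟩

theorem IsBisimulation.leanClosure {P : TSS Sg Var A} (hP : P.IsNtyftNtyxtWithRecursion)
    {B : ClosedTerm Sg Var → ClosedTerm Sg Var → Prop} [Std.Refl B] (hB : P.IsBisimulation B) :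
    P.IsBisimulation (LeanClosure B) where
  certain p q a p' hpq h :=
    (hB.leanClosure_stage hP _ le_rfl).1 p q a p' hpq (certain_iff.1 h)
  possible p q a q' hpq h := by
    obtain ⟨p', hp', hr⟩ := (hB.leanClosure_stage hP _ le_rfl).2 p q a q' hpq h
    exact ⟨p', possible_iff.2 hp', hr⟩

theorem isBisimulation_bisimPreorder (P : TSS Sg Var A) : P.IsBisimulation P.BisimPreorder where
  certain := by
    rintro p q a p' ⟨R, hR, hpq⟩ h
    obtain ⟨q', hq', hr⟩ := hR.certain p q a p' hpq h
    exact ⟨q', hq', R, hR, hr⟩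
  possible := by
    rintro p q a q' ⟨R, hR, hpq⟩ h
    obtain ⟨p', hp', hr⟩ := hR.possible p q a q' hpq h
    exact ⟨p', hp', R, hR, hr⟩

theorem bisimPreorder_refl (P : TSS Sg Var A) (p : ClosedTerm Sg Var) : P.BisimPreorder p p :=
  ⟨Eq, ⟨by rintro p _ a p' rfl h; exact ⟨p', h, rfl⟩,
    by rintro p _ a p' rfl h; exact ⟨p', h, rfl⟩⟩, rfl⟩

theorem bisimPreorder_trans (P : TSS Sg Var A) {p q s : ClosedTerm Sg Var}
    (hpq : P.BisimPreorder p q) (hqs : P.BisimPreorder q s) : P.BisimPreorder p s := by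
  refine ⟨fun p s => ∃ q, P.BisimPreorder p q ∧ P.BisimPreorder q s, ⟨?_, ?_⟩, q, hpq, hqs⟩
  · rintro p s a p' ⟨q, hpq, hqs⟩ h
    obtain ⟨q', hq', hr⟩ := P.isBisimulation_bisimPreorder.certain p q a p' hpq h
    obtain ⟨s', hs', hr'⟩ := P.isBisimulation_bisimPreorder.certain q s a q' hqs hq'
    exact ⟨s', hs', q', hr, hr'⟩
  · rintro p s a s' ⟨q, hpq, hqs⟩ h
    obtain ⟨q', hq', hr⟩ := P.isBisimulation_bisimPreorder.possible q s a s' hqs h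
    obtain ⟨p', hp', hr'⟩ := P.isBisimulation_bisimPreorder.possible p q a q' hpq hq'
    exact ⟨p', hp', q', hr', hr⟩

end TSS

theorem mainTheorem1 {Sg : Signature.{w}} {Var : Type u} {A : Type v} (P : TSS Sg Var A)
    (hP : P.IsNtyftNtyxtWithRecursion) : IsLeanPrecongruence P.BisimPreorder where
  refl := P.bisimPreorder_refl
  trans _ _ _ := P.bisimPreorder_trans
  lean t _ _ h :=
    have : Std.Refl P.BisimPreorder := ⟨P.bisimPreorder_refl⟩
    ⟨_, P.isBisimulation_bisimPreorder.leanClosure hP, LeanClosure.of_subst t h⟩
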